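/- Call a family $\mathcal D$ of subsets of a topological space discrete if each point has a neighborhood that intersects at most one member of $\mathcal D$; a closed disk in $\mathbb R^2$ is a subset of $\mathbb R^2$ that is homeomorphic to the closed unit disk. Let $\mathcal D$ be a discrete family of closed disks in $\mathbb R^2$, and let $A$ and $B$ be two subsets of $\mathbb R^2\setminus\bigcup\mathcal D$ such that $B(0,r)\cap(A\cup B)$ is finite for every $r>0$, where $B(0,r)$ denotes the open ball of radius $r$ about the origin. Then for every bijection $g\colon A\to B$ there exists a homeomorphism $f\colon\mathbb R^2\to\mathbb R^2$ such that $f(a)=g(a)$ for all $a\in A$ and $f(x)=x$ for every $x\in D$ and every $D\in\mathcal D$. -/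

import Mathlib

open Topology

/-- A family `𝒟` of subsets of a topological space is discrete if every point has a neighbourhood
that intersects at most one member of `𝒟`. -/
def IsDiscreteFamily {X : Type*} [TopologicalSpace X] (𝒟 : Set (Set X)) : Prop :=
  ∀ x : X, ∃ U ∈ 𝓝 x, {D ∈ 𝒟 | (D ∩ U).Nonempty}.Subsingleton

/-- A closed disk in the plane, in the topological sense: a subset that is homeomorphic to the
closed unit disk. All round closed disks of positive radius are examples. -/
def IsClosedDisk (D : Set (EuclideanSpace ℝ (Fin 2))) : Prop :=
  Nonempty (D ≃ₜ Metric.closedBall (0 : EuclideanSpace ℝ (Fin 2)) 1)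

-- Removing a discrete family of disks from the plane leaves a connected set, even near infinity. A
-- continuous retraction onto a disk, combined with a winding number argument, shows that a disk
-- does not separate the plane. Unicoherence of the plane, also proved with logarithms, shows that
-- removing a whole discrete family keeps a connected open set connected
-- (`isPreconnected_sdiff_sUnion`). So points far from the origin can be moved far from the origin,
-- off the disks.
--
-- If the sources and targets form disjoint locally finite sets, cut the indices into finite blocks
-- and move the n-th block inside a connected open set outside a ball of radius `ρ n`, with support
-- in the ball of radius `ρ (n + 2)`. Supports of stages of equal parity are then disjoint and
-- locally finite, so all even stages glue to one homeomorphism and all odd ones to another; their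
-- composite does the job.
--
-- In general `A` and `B` may overlap, so `A` is first moved to a nearby set disjoint from both, and
-- that set is then moved to `B`.

local notation "E" => EuclideanSpace ℝ (Fin 2)

/-! ### Continuous logarithms and unicoherence. -/

/-- Two continuous logarithms of the same function differ by a constant on a preconnected set. -/
theorem IsPreconnected.sub_eq_sub_of_exp_eq {X : Type*} [TopologicalSpace X] {S : Set X}
    (hS : IsPreconnected S) {a b : X → ℂ} (ha : ContinuousOn a S) (hb : ContinuousOn b S)
    (hab : ∀ x ∈ S, Complex.exp (a x) = Complex.exp (b x)) {x y : X} (hx : x ∈ S) (hy : y ∈ S) :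
    a x - b x = a y - b y := by
  have h : ∀ x : X, ∃ n : ℤ, x ∈ S → a x = b x + n * (2 * Real.pi * Complex.I) := by
    intro x
    by_cases hx : x ∈ S
    · obtain ⟨n, hn⟩ := Complex.exp_eq_exp_iff_exists_int.1 (hab x hx)
      exact ⟨n, fun _ => hn⟩
    · exact ⟨0, fun h => absurd h hx⟩
  choose n hn using h
  have hpi : (2 * Real.pi * Complex.I : ℂ) ≠ 0 := by
    simp [Real.pi_ne_zero]
  have hc : ContinuousOn n S := by
    rw [Int.isClosedEmbedding_coe_real.isInducing.continuousOn_iff]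
    have : ContinuousOn (fun x => ((a x - b x) / (2 * Real.pi * Complex.I)).re) S := by fun_prop
    refine this.congr fun x hx => ?_
    have : (a x - b x) / (2 * Real.pi * Complex.I) = ((n x : ℝ) : ℂ) := by
      rw [hn x hx, div_eq_iff hpi]; push_cast; ring
    simp only [Function.comp_apply, this, Complex.ofReal_re]
  have := hS.constant hc hx hy
  rw [hn x hx, hn y hy, this]; ring

/-- On a simply connected, locally path connected space, every continuous nowhere vanishing complex
function has a continuous logarithm. -/
theorem exists_continuous_log {X : Type*} [TopologicalSpace X] [SimplyConnectedSpace X]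
    [LocallyPathConnectedSpace X] {h : X → ℂ} (hc : Continuous h) (h0 : ∀ x, h x ≠ 0) :
    ∃ φ : X → ℂ, Continuous φ ∧ ∀ x, Complex.exp (φ x) = h x := by
  obtain ⟨x₀⟩ : Nonempty X := inferInstance
  obtain ⟨F, ⟨-, hF⟩, -⟩ := Complex.isCoveringMapOn_exp.existsUnique_continuousMap_lifts
    (⟨h, hc⟩ : C(X, ℂ)) (Complex.exp_log (h0 x₀)) h0
  exact ⟨F, F.continuous, fun x => congrFun hF x⟩

/-- Simply connected spaces are unicoherent with respect to open sets: if two connected open sets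
cover the space, then their intersection is connected. -/
theorem IsPreconnected.inter_of_union_eq_univ {X : Type*} [TopologicalSpace X] [NormalSpace X]
    [SimplyConnectedSpace X] [LocallyPathConnectedSpace X] {U V : Set X}
    (hU : IsPreconnected U) (hV : IsPreconnected V) (hUo : IsOpen U) (hVo : IsOpen V)
    (hUV : U ∪ V = Set.univ) : IsPreconnected (U ∩ V) := by
  classical
  rw [isPreconnected_iff_subset_of_disjoint]
  intro u v hu hv huv hd
  by_contra! hcon
  obtain ⟨⟨q, hq, hqu⟩, p, hp, hpv⟩ := And.imp Set.not_subset.1 Set.not_subset.1 hcon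
  set Q := U ∩ V ∩ v with hQ
  have hQo : IsOpen Q := (hUo.inter hVo).inter hv
  have hPo : IsOpen (U ∩ V ∩ u) := (hUo.inter hVo).inter hu
  have hfr : ∀ x ∈ frontier Q, x ∉ U ∨ x ∉ V := by
    intro x hx
    by_contra! h
    rcases huv ⟨h.1, h.2⟩ with hxu | hxv
    · obtain ⟨y, hy, hyQ⟩ := mem_closure_iff.1 hx.1 _ hPo ⟨⟨h.1, h.2⟩, hxu⟩
      exact Set.notMem_empty y (hd ▸ ⟨hyQ.1, hy.2, hyQ.2⟩)
    · exact hx.2 (by rw [hQo.interior_eq]; exact ⟨⟨h.1, h.2⟩, hxv⟩)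
  have hdisj : Disjoint Vᶜ Uᶜ := by
    rw [Set.disjoint_compl_left_iff_subset]
    intro x hx
    have := hUV ▸ Set.mem_univ x
    exact this.resolve_left hx
  obtain ⟨lam, hl0, hl1, -⟩ := exists_continuous_zero_one_of_isClosed hVo.isClosed_compl
    hUo.isClosed_compl hdisj
  have hl0' : ∀ x, x ∉ V → lam x = 0 := fun x hx => hl0 hx
  have hl1' : ∀ x, x ∉ U → lam x = 1 := fun x hx => hl1 hx
  set c : ℂ := 2 * Real.pi * Complex.I with hc
  have hc0 : c ≠ 0 := by simp [c, Real.pi_ne_zero]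
  have hexpc : Complex.exp c = 1 := Complex.exp_two_pi_mul_I
  have hcont : Continuous fun x => c * (lam x : ℂ) := by fun_prop
  -- This function is continuous because `c * lam` is `0` or `c` on the frontier of `Q`. Its
  -- logarithm is compared with `c * lam` on `Q ∩ U` and with `c * lam - c` on `Q ∩ V`; going from
  -- `p` to `q` through `U` and through `V` then gives results differing by `c ≠ 0`.
  obtain ⟨φ, hφc, hφ⟩ := exists_continuous_log
    (h := Q.piecewise (fun x => Complex.exp (c * lam x)) fun _ => 1)
    (by
      refine Continuous.piecewise (fun x hx => ?_) (by fun_prop) continuous_const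
      rcases hfr x hx with h | h
      · simp [hl1' x h, hexpc]
      · simp [hl0' x h])
    (fun x => by by_cases hx : x ∈ Q <;> simp [hx])
  have hpQ : p ∉ Q := fun h => hpv h.2
  have hqQ : q ∈ Q := ⟨hq, (huv hq).resolve_left hqu⟩
  have h1 := hU.sub_eq_sub_of_exp_eq (a := φ) (b := Q.piecewise (fun x => c * lam x) fun _ => 0)
    hφc.continuousOn
    (by
      refine ContinuousOn.piecewise (fun x hx => ?_) hcont.continuousOn continuousOn_const
      simp [hl0' x ((hfr x hx.2).resolve_left (not_not.2 hx.1))])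
    (fun x _ => by rw [hφ x]; by_cases h : x ∈ Q <;> simp [h]) hp.1 hq.1
  have h2 := hV.sub_eq_sub_of_exp_eq (a := φ)
    (b := Q.piecewise (fun x => c * lam x - c) fun _ => 0)
    hφc.continuousOn
    (by
      refine ContinuousOn.piecewise (fun x hx => ?_) (by fun_prop) continuousOn_const
      simp [hl1' x ((hfr x hx.2).resolve_right (not_not.2 hx.1))])
    (fun x _ => by rw [hφ x]; by_cases h : x ∈ Q <;> simp [h, Complex.exp_sub, hexpc]) hp.2 hq.2
  simp only [Set.piecewise_eq_of_notMem _ _ _ hpQ, Set.piecewise_eq_of_mem _ _ _ hqQ] at h1 h2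
  exact hc0 (by linear_combination h1 - h2)

/-- No continuous nowhere vanishing function on the plane agrees with a translate of the standard
coordinate near infinity. -/
theorem not_forall_eq_sub_of_norm_gt {h : E → ℂ} (hc : Continuous h) (h0 : ∀ x, h x ≠ 0) (p : E)
    (R : ℝ) : ¬ ∀ x, R < ‖x - p‖ → h x = Complex.orthonormalBasisOneI.repr.symm (x - p) := by
  intro hR
  obtain ⟨φ, hφc, hφ⟩ := exists_continuous_log hc h0
  set r : ℝ := |R| + 1
  have hr : 0 < r := by positivity
  -- A circle about `p` in the region where `h` is known: one turn adds `2πi` to the explicit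
  -- logarithm, while `φ ∘ γ` returns to its initial value.
  let γ : ℝ → E := fun t =>
    p + Complex.orthonormalBasisOneI.repr (Complex.exp (Real.log r + t * Complex.I))
  have hγ : Continuous γ := by fun_prop
  have hexp : ∀ t : ℝ, Complex.exp (φ (γ t)) = Complex.exp (Real.log r + t * Complex.I) := by
    intro t
    rw [hφ, hR]
    · simp [γ]
    · have : ‖γ t - p‖ = r := by
        simp [γ, Complex.norm_exp, Real.exp_log hr]
      rw [this]
      exact (le_abs_self R).trans_lt (lt_add_one _)
  have := isPreconnected_univ.sub_eq_sub_of_exp_eq (a := fun t => φ (γ t))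
    (b := fun t : ℝ => (Real.log r + t * Complex.I : ℂ)) (by fun_prop) (by fun_prop)
    (fun t _ => hexp t) (Set.mem_univ 0) (Set.mem_univ (2 * Real.pi))
  have hper : γ (2 * Real.pi) = γ 0 := by
    simp only [γ]
    congr 2
    push_cast
    rw [Complex.exp_add, Complex.exp_two_pi_mul_I]
    simp
  simp [hper, Real.pi_ne_zero] at this

/-! ### Closed disks do not separate the plane. -/

theorem one_lt_rank_plane : 1 < Module.rank ℝ E := by
  rw [rank_eq_card_basis (EuclideanSpace.basisFun (Fin 2) ℝ).toBasis]
  simp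

/-- Pushing radially outward by `R` maps the punctured space onto this complement. -/
theorem isConnected_compl_closedBall_of_one_lt_rank {F : Type*} [NormedAddCommGroup F]
    [NormedSpace ℝ F] (h : 1 < Module.rank ℝ F) {R : ℝ} (hR : 0 ≤ R) :
    IsConnected (Metric.closedBall (0 : F) R)ᶜ := by
  have hc := (isConnected_compl_singleton_of_one_lt_rank h (0 : F))
  have : (Metric.closedBall (0 : F) R)ᶜ = (fun x : F => x + (R * ‖x‖⁻¹) • x) '' {0}ᶜ := by
    ext y
    simp only [Set.mem_compl_iff, Metric.mem_closedBall, dist_zero_right, not_le, Set.mem_image,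
      Set.mem_singleton_iff]
    constructor
    · intro hy
      have hy0 : 0 < ‖y‖ := hR.trans_lt hy
      have hpos : 0 < ‖y‖ - R := sub_pos.2 hy
      refine ⟨((‖y‖ - R) * ‖y‖⁻¹) • y, ?_, ?_⟩
      · simp [hpos.ne', norm_pos_iff.1 hy0]
      · rw [norm_smul, norm_mul, norm_inv, norm_norm, Real.norm_of_nonneg hpos.le, smul_smul,
          ← add_smul]
        convert one_smul ℝ y using 2
        field_simp
        ring
    · rintro ⟨x, hx, rfl⟩
      have hx0 : 0 < ‖x‖ := norm_pos_iff.2 hx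
      have : x + (R * ‖x‖⁻¹) • x = (1 + R * ‖x‖⁻¹) • x := by rw [add_smul, one_smul]
      rw [this, norm_smul, Real.norm_of_nonneg (by positivity)]
      have : (1 + R * ‖x‖⁻¹) * ‖x‖ = ‖x‖ + R := by field_simp
      linarith
  rw [this]
  refine hc.image _ (ContinuousOn.add continuousOn_id (ContinuousOn.smul ?_ continuousOn_id))
  exact continuousOn_const.mul (continuousOn_id.norm.inv₀ fun x hx => norm_ne_zero_iff.2 hx)

theorem exists_retraction_closedBall {F : Type*} [NormedAddCommGroup F] [NormedSpace ℝ F] :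
    ∃ ρ : F → F, Continuous ρ ∧ (∀ x, ρ x ∈ Metric.closedBall (0 : F) 1) ∧
      ∀ x ∈ Metric.closedBall (0 : F) 1, ρ x = x := by
  refine ⟨fun x => (max 1 ‖x‖)⁻¹ • x, ?_, fun x => ?_, fun x hx => ?_⟩
  · refine Continuous.smul (Continuous.inv₀ (by fun_prop) fun x => ?_) continuous_id
    exact (zero_lt_one.trans_le (le_max_left _ _)).ne'
  · have : (0 : ℝ) < max 1 ‖x‖ := zero_lt_one.trans_le (le_max_left _ _)
    rw [mem_closedBall_zero_iff, norm_smul, norm_inv, Real.norm_of_nonneg this.le,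
      inv_mul_le_one₀ this]
    exact le_max_right _ _
  · rw [mem_closedBall_zero_iff] at hx
    simp [max_eq_left hx]

theorem IsClosedDisk.isCompact {D : Set E} (hD : IsClosedDisk D) : IsCompact D := by
  obtain ⟨e⟩ := hD
  have := isCompact_iff_compactSpace.1 (isCompact_closedBall (0 : E) 1)
  exact isCompact_iff_compactSpace.2 e.symm.compactSpace

theorem IsClosedDisk.isConnected {D : Set E} (hD : IsClosedDisk D) : IsConnected D := by
  obtain ⟨e⟩ := hD
  have := isConnected_iff_connectedSpace.1 (Metric.isConnected_closedBall (x := (0 : E)) zero_le_one)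
  exact isConnected_iff_connectedSpace.2 (e.symm.surjective.connectedSpace e.symm.continuous)

/-- Tietze extends the chart of `D` to the plane; project radially to the unit ball and apply the
inverse chart. -/
theorem IsClosedDisk.exists_retraction {D : Set E} (hD : IsClosedDisk D) :
    ∃ r : E → E, Continuous r ∧ (∀ x, r x ∈ D) ∧ ∀ x ∈ D, r x = x := by
  have hcl := hD.isCompact.isClosed
  obtain ⟨e⟩ := hD
  obtain ⟨ρ, hρc, hρm, hρ⟩ := exists_retraction_closedBall (F := E)
  obtain ⟨g, hg⟩ := ContinuousMap.exists_restrict_eq hcl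
    (⟨fun x => (e x : E), by fun_prop⟩ : C(D, E))
  refine ⟨fun x => e.symm ⟨ρ (g x), hρm _⟩, by fun_prop, fun x => Subtype.coe_prop _, ?_⟩
  intro x hx
  have h1 : g x = e ⟨x, hx⟩ := DFunLike.congr_fun hg ⟨x, hx⟩
  have h2 : (⟨ρ (g x), hρm _⟩ : Metric.closedBall (0 : E) 1) = e ⟨x, hx⟩ := by
    ext1
    rw [h1]
    exact hρ _ (Subtype.coe_prop _)
  simp [h2]

/-- A closed disk does not separate the plane. -/
theorem IsClosedDisk.isPreconnected_compl {D : Set E} (hD : IsClosedDisk D) :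
    IsPreconnected Dᶜ := by
  classical
  obtain ⟨r, hrc, hrD, hr⟩ := hD.exists_retraction
  have hcl := hD.isCompact.isClosed
  obtain ⟨R, hR⟩ := hD.isCompact.isBounded.subset_closedBall 0
  have hconn := isConnected_compl_closedBall_of_one_lt_rank one_lt_rank_plane (le_max_right R 0)
  have hsub : (Metric.closedBall (0 : E) (max R 0))ᶜ ⊆ Dᶜ :=
    Set.compl_subset_compl.2 (hR.trans (Metric.closedBall_subset_closedBall (le_max_left _ _)))
  obtain ⟨z, hz⟩ := hconn.nonempty
  have key : ∀ p ∈ Dᶜ, ((connectedComponentIn Dᶜ p) ∩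
      (Metric.closedBall (0 : E) (max R 0))ᶜ).Nonempty := by
    intro p hp
    by_contra hne
    set V := connectedComponentIn Dᶜ p
    have hVo : IsOpen V := hcl.isOpen_compl.connectedComponentIn
    have hVsub : ∀ x ∈ V, ‖x‖ ≤ max R 0 := by
      intro x hx
      by_contra hxR
      exact hne ⟨x, hx, by simpa using hxR⟩
    have hfr : ∀ x ∈ frontier V, x ∈ D := by
      intro x hx
      by_contra hxD
      have hxc : connectedComponentIn Dᶜ x ∈ 𝓝 x :=
        hcl.isOpen_compl.connectedComponentIn.mem_nhds (mem_connectedComponentIn hxD)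
      obtain ⟨y, hy, hyV⟩ := mem_closure_iff_nhds.1 hx.1 _ hxc
      apply hx.2
      rw [hVo.interior_eq]
      have e1 := connectedComponentIn_eq hy
      have e2 := connectedComponentIn_eq hyV
      change x ∈ connectedComponentIn Dᶜ p
      rw [e2, ← e1]
      exact mem_connectedComponentIn hxD
    -- On the bounded component `V` replace `x` by `r x`. The pieces agree on the frontier of `V`,
    -- which lies in `D`, and `p` is never hit.
    refine not_forall_eq_sub_of_norm_gt
      (h := V.piecewise (fun x => Complex.orthonormalBasisOneI.repr.symm (r x - p))
        fun x => Complex.orthonormalBasisOneI.repr.symm (x - p)) ?_ ?_ p (max R 0 + ‖p‖) ?_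
    · refine Continuous.piecewise (fun x hx => ?_) (by fun_prop) (by fun_prop)
      rw [hr x (hfr x hx)]
    · intro x
      by_cases hx : x ∈ V
      · rw [Set.piecewise_eq_of_mem _ _ _ hx]
        simp only [ne_eq, LinearIsometryEquiv.map_eq_zero_iff, sub_eq_zero]
        rintro rfl
        exact hp (hrD x)
      · rw [Set.piecewise_eq_of_notMem _ _ _ hx]
        simp only [ne_eq, LinearIsometryEquiv.map_eq_zero_iff, sub_eq_zero]
        rintro rfl
        exact hx (mem_connectedComponentIn hp)
    · intro x hx
      refine Set.piecewise_eq_of_notMem _ _ _ fun hxV => ?_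
      have := norm_sub_le x p
      linarith [hVsub x hxV]
  refine isPreconnected_of_forall z fun p hp => ?_
  obtain ⟨y, hyV, hy⟩ := key p hp
  refine ⟨connectedComponentIn Dᶜ p ∪ (Metric.closedBall (0 : E) (max R 0))ᶜ,
    Set.union_subset (connectedComponentIn_subset _ _) hsub, Or.inr hz,
    Or.inl (mem_connectedComponentIn hp), ?_⟩
  exact isPreconnected_connectedComponentIn.union y hyV hy hconn.isPreconnected

/-! ### Complements of discrete families. -/

theorem IsDiscreteFamily.mono {X : Type*} [TopologicalSpace X] {𝒟 𝒟' : Set (Set X)}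
    (h : IsDiscreteFamily 𝒟) (hs : 𝒟' ⊆ 𝒟) : IsDiscreteFamily 𝒟' := fun x => by
  obtain ⟨U, hU, hs'⟩ := h x
  exact ⟨U, hU, hs'.anti fun D hD => ⟨hs hD.1, hD.2⟩⟩

theorem IsDiscreteFamily.locallyFinite {X : Type*} [TopologicalSpace X] {𝒟 : Set (Set X)}
    (h : IsDiscreteFamily 𝒟) : LocallyFinite fun D : 𝒟 => (D : Set X) := fun x => by
  obtain ⟨U, hU, hs⟩ := h x
  refine ⟨U, hU, Set.Subsingleton.finite fun D hD D' hD' => Subtype.ext ?_⟩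
  exact hs ⟨D.2, hD⟩ ⟨D'.2, hD'⟩

theorem IsDiscreteFamily.isClosed_sUnion {X : Type*} [TopologicalSpace X] {𝒟 : Set (Set X)}
    (h : IsDiscreteFamily 𝒟) (hc : ∀ D ∈ 𝒟, IsClosed D) : IsClosed (⋃₀ 𝒟) := by
  rw [Set.sUnion_eq_iUnion]
  exact h.locallyFinite.isClosed_iUnion fun D => hc D D.2

theorem IsDiscreteFamily.eq_of_mem {X : Type*} [TopologicalSpace X] {𝒟 : Set (Set X)}
    (h : IsDiscreteFamily 𝒟) {D D' : Set X} (hD : D ∈ 𝒟) (hD' : D' ∈ 𝒟) {x : X} (hx : x ∈ D)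
    (hx' : x ∈ D') : D = D' := by
  obtain ⟨U, hU, hs⟩ := h x
  exact hs ⟨hD, x, hx, mem_of_mem_nhds hU⟩ ⟨hD', x, hx', mem_of_mem_nhds hU⟩

/-- Removing a discrete family of connected, nonseparating closed sets from a connected open set
leaves a connected set. -/
theorem isPreconnected_sdiff_sUnion {X : Type*} [TopologicalSpace X] [NormalSpace X]
    [SimplyConnectedSpace X] [LocallyPathConnectedSpace X] {O : Set X} (hO : IsPreconnected O)
    (hOo : IsOpen O) {𝒦 : Set (Set X)} (h𝒦 : IsDiscreteFamily 𝒦) (hcl : ∀ K ∈ 𝒦, IsClosed K)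
    (hconn : ∀ K ∈ 𝒦, IsConnected K) (hcompl : ∀ K ∈ 𝒦, IsPreconnected Kᶜ)
    (hsub : ∀ K ∈ 𝒦, (K ∩ O).Nonempty → K ⊆ O) : IsPreconnected (O \ ⋃₀ 𝒦) := by
  classical
  have hnbhd : ∀ K ∈ 𝒦, ∃ N : Set X, (K ∩ O).Nonempty → IsOpen N ∧ K ⊆ N ∧
      N ⊆ O \ ⋃₀ (𝒦 \ {K}) ∧ IsPreconnected (N \ K) := by
    intro K hK
    by_cases hKO : (K ∩ O).Nonempty
    swap
    · exact ⟨∅, fun h => absurd h hKO⟩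
    obtain ⟨x, hx⟩ := (hconn K hK).nonempty
    have hG : IsOpen (O \ ⋃₀ (𝒦 \ {K})) :=
      hOo.sdiff ((h𝒦.mono Set.sdiff_subset).isClosed_sUnion fun D hD => hcl D hD.1)
    have hKG : K ⊆ O \ ⋃₀ (𝒦 \ {K}) := by
      intro y hy
      refine ⟨hsub K hK hKO hy, ?_⟩
      rintro ⟨K', hK', hyK'⟩
      exact hK'.2 (h𝒦.eq_of_mem hK'.1 hK hyK' hy)
    have hKN := (hconn K hK).isPreconnected.subset_connectedComponentIn hx hKG
    refine ⟨connectedComponentIn (O \ ⋃₀ (𝒦 \ {K})) x, fun _ => ⟨hG.connectedComponentIn,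
      hKN, connectedComponentIn_subset _ _, ?_⟩⟩
    rw [Set.sdiff_eq]
    refine isPreconnected_connectedComponentIn.inter_of_union_eq_univ (hcompl K hK)
      hG.connectedComponentIn (hcl K hK).isOpen_compl ?_
    rw [← Set.compl_subset_iff_union.1 (Set.compl_subset_compl.2 hKN), Set.union_comm]
  choose! N hN using hnbhd
  set W := O \ ⋃₀ 𝒦
  have hWo : IsOpen W := hOo.sdiff (h𝒦.isClosed_sUnion hcl)
  have hNW : ∀ K ∈ 𝒦, (K ∩ O).Nonempty → N K \ K ⊆ W := by
    intro K hK hKO y hy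
    have := (hN K hK hKO).2.2.1 hy.1
    refine ⟨this.1, ?_⟩
    rintro ⟨K', hK', hyK'⟩
    exact this.2 ⟨K', ⟨hK', fun h => hy.2 (h ▸ hyK')⟩, hyK'⟩
  rw [isPreconnected_iff_subset_of_disjoint]
  intro u v hu hv huv hd
  -- Each `K` joins the side containing its punctured neighborhood `N K \ K`, so a separation of `W`
  -- extends to one of `O`.
  set 𝒮 := {K ∈ 𝒦 | (K ∩ O).Nonempty ∧ N K \ K ⊆ u}
  set 𝒯 := {K ∈ 𝒦 | (K ∩ O).Nonempty ∧ ¬ N K \ K ⊆ u}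
  have h𝒯 : ∀ K ∈ 𝒯, N K \ K ⊆ v := by
    rintro K ⟨hK, hKO, hKu⟩
    have hpre := (hN K hK hKO).2.2.2
    rw [isPreconnected_iff_subset_of_disjoint] at hpre
    refine (hpre u v hu hv ((hNW K hK hKO).trans huv) ?_).resolve_left hKu
    exact Set.subset_empty_iff.1 (hd ▸ Set.inter_subset_inter_left _ (hNW K hK hKO))
  have hPo : IsOpen ((W ∩ u) ∪ ⋃ K ∈ 𝒮, N K) :=
    (hWo.inter hu).union (isOpen_biUnion fun K hK => (hN K hK.1 hK.2.1).1)
  have hQo : IsOpen ((W ∩ v) ∪ ⋃ K ∈ 𝒯, N K) :=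
    (hWo.inter hv).union (isOpen_biUnion fun K hK => (hN K hK.1 hK.2.1).1)
  have hnot : ∀ x, x ∈ W → x ∈ u → x ∈ v → False := fun x h1 h2 h3 =>
    Set.notMem_empty x (hd ▸ ⟨h1, h2, h3⟩)
  have hW𝒦 : ∀ x ∈ W, ∀ K ∈ 𝒦, x ∉ K := fun x hx K hK hxK => hx.2 ⟨K, hK, hxK⟩
  rw [isPreconnected_iff_subset_of_disjoint] at hO
  have hcases := hO _ _ hPo hQo ?_ ?_
  · have aux1 : ∀ x ∈ W, x ∈ (W ∩ u) ∪ ⋃ K ∈ 𝒮, N K → x ∈ u := by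
      rintro x hx (h | h)
      · exact h.2
      · obtain ⟨K, hK, hxK⟩ := Set.mem_iUnion₂.1 h
        exact hK.2.2 ⟨hxK, hW𝒦 x hx K hK.1⟩
    have aux2 : ∀ x ∈ W, x ∈ (W ∩ v) ∪ ⋃ K ∈ 𝒯, N K → x ∈ v := by
      rintro x hx (h | h)
      · exact h.2
      · obtain ⟨K, hK, hxK⟩ := Set.mem_iUnion₂.1 h
        exact h𝒯 K hK ⟨hxK, hW𝒦 x hx K hK.1⟩
    exact hcases.imp (fun h x hx => aux1 x hx (h hx.1)) fun h x hx => aux2 x hx (h hx.1)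
  · intro x hx
    by_cases hxW : x ∈ W
    · exact (huv hxW).imp (fun h => Or.inl ⟨hxW, h⟩) fun h => Or.inl ⟨hxW, h⟩
    · obtain ⟨K, hK, hxK⟩ : x ∈ ⋃₀ 𝒦 := by
        by_contra h
        exact hxW ⟨hx, h⟩
      have hKO : (K ∩ O).Nonempty := ⟨x, hxK, hx⟩
      have hxN := (hN K hK hKO).2.1 hxK
      by_cases hKu : N K \ K ⊆ u
      · exact Or.inl (Or.inr (Set.mem_iUnion₂.2 ⟨K, ⟨hK, hKO, hKu⟩, hxN⟩))
      · exact Or.inr (Or.inr (Set.mem_iUnion₂.2 ⟨K, ⟨hK, hKO, hKu⟩, hxN⟩))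
  · rw [Set.eq_empty_iff_forall_notMem]
    rintro x ⟨-, hP, hQ⟩
    rcases hP with hP | hP <;> rcases hQ with hQ | hQ
    · exact hnot x hP.1 hP.2 hQ.2
    · obtain ⟨K, hK, hxK⟩ := Set.mem_iUnion₂.1 hQ
      exact hnot x hP.1 hP.2 (h𝒯 K hK ⟨hxK, hW𝒦 x hP.1 K hK.1⟩)
    · obtain ⟨K, hK, hxK⟩ := Set.mem_iUnion₂.1 hP
      exact hnot x hQ.1 (hK.2.2 ⟨hxK, hW𝒦 x hQ.1 K hK.1⟩) hQ.2
    · obtain ⟨K, hK, hxK⟩ := Set.mem_iUnion₂.1 hP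
      obtain ⟨K', hK', hxK'⟩ := Set.mem_iUnion₂.1 hQ
      have hne : K ≠ K' := by
        rintro rfl
        exact hK'.2.2 hK.2.2
      have h1 : x ∉ K := fun h =>
        ((hN K' hK'.1 hK'.2.1).2.2.1 hxK').2 ⟨K, ⟨hK.1, hne⟩, h⟩
      have h2 : x ∉ K' := fun h =>
        ((hN K hK.1 hK.2.1).2.2.1 hxK).2 ⟨K', ⟨hK'.1, hne.symm⟩, h⟩
      exact hnot x (hNW K hK.1 hK.2.1 ⟨hxK, h1⟩) (hK.2.2 ⟨hxK, h1⟩) (h𝒯 K' hK' ⟨hxK', h2⟩)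

/-- A closed discrete set, given through the closedness of all its subsets, does not disconnect
a connected open subset of the plane. -/
theorem IsPreconnected.diff_of_forall_subset_isClosed {W Z : Set E} (hW : IsPreconnected W)
    (hWo : IsOpen W) (hZ : ∀ Z' ⊆ Z, IsClosed Z') : IsPreconnected (W \ Z) := by
  have hU : ⋃₀ ((fun z : E => ({z} : Set E)) '' Z) = Z := by
    simp
  rw [← hU]
  refine isPreconnected_sdiff_sUnion hW hWo ?_ ?_ ?_ ?_ ?_
  · intro x
    refine ⟨(Z \ {x})ᶜ, (hZ _ Set.sdiff_subset).isOpen_compl.mem_nhds (by simp), ?_⟩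
    have : ∀ D ∈ {D ∈ (fun z : E => ({z} : Set E)) '' Z | (D ∩ (Z \ {x})ᶜ).Nonempty}, D = {x} := by
      rintro _ ⟨⟨z, hz, rfl⟩, y, hy, hyZ⟩
      obtain rfl : y = z := hy
      by_contra hne
      exact hyZ ⟨hz, fun h => hne (by rw [Set.mem_singleton_iff.1 h])⟩
    intro D hD D' hD'
    rw [this D hD, this D' hD']
  · rintro _ ⟨z, -, rfl⟩
    exact isClosed_singleton
  · rintro _ ⟨z, -, rfl⟩
    exact isConnected_singleton
  · rintro _ ⟨z, -, rfl⟩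
    exact (isConnected_compl_singleton_of_one_lt_rank one_lt_rank_plane z).isPreconnected
  · rintro _ ⟨z, -, rfl⟩ ⟨y, hy, hyW⟩
    obtain rfl : y = z := hy
    simpa using hyW

/-- The points of the complement of a discrete family of closed disks that are far away from the
origin lie in one connected open subset of this complement that misses a given ball. -/
theorem exists_isPreconnected_open_of_norm_ge {𝒟 : Set (Set E)} (h𝒟 : IsDiscreteFamily 𝒟)
    (hdisk : ∀ D ∈ 𝒟, IsClosedDisk D) (ρ : ℝ) :
    ∃ T : ℝ, ρ ≤ T ∧ (ρ < 0 → T = 0) ∧ ∃ W : Set E, IsOpen W ∧ IsPreconnected W ∧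
      (∀ x ∈ W, ρ < ‖x‖) ∧ W ⊆ (⋃₀ 𝒟)ᶜ ∧ ∀ x ∉ ⋃₀ 𝒟, T ≤ ‖x‖ → x ∈ W := by
  have hcl : ∀ D ∈ 𝒟, IsClosed D := fun D hD => (hdisk D hD).isCompact.isClosed
  have hgen : ∀ O : Set E, IsOpen O → IsPreconnected O → (∀ D ∈ 𝒟, (D ∩ O).Nonempty → D ⊆ O) →
      IsPreconnected (O \ ⋃₀ 𝒟) := fun O hOo hO hs =>
    isPreconnected_sdiff_sUnion hO hOo h𝒟 hcl (fun D hD => (hdisk D hD).isConnected)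
      (fun D hD => (hdisk D hD).isPreconnected_compl) hs
  rcases lt_or_ge ρ 0 with hρ | hρ
  · refine ⟨0, hρ.le, fun _ => rfl, Set.univ \ ⋃₀ 𝒟,
      isOpen_univ.sdiff (h𝒟.isClosed_sUnion hcl),
      hgen _ isOpen_univ isPreconnected_univ fun D _ _ => Set.subset_univ D, fun x _ =>
      hρ.trans_le (norm_nonneg x), fun x hx => hx.2, fun x hx _ => ⟨trivial, hx⟩⟩
  -- Adding the disks that meet the ball to it leaves every other disk disjoint from `C`, hence
  -- inside one component of the complement.
  set 𝒞 := {D ∈ 𝒟 | (D ∩ Metric.closedBall 0 ρ).Nonempty}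
  have hfin : 𝒞.Finite := by
    have := (h𝒟.locallyFinite.finite_nonempty_inter_compact
      (isCompact_closedBall (0 : E) ρ)).image ((↑) : 𝒟 → Set E)
    refine this.subset ?_
    rintro D ⟨hD, hne⟩
    exact ⟨⟨D, hD⟩, hne, rfl⟩
  set C := Metric.closedBall (0 : E) ρ ∪ ⋃₀ 𝒞
  have hC : IsCompact C :=
    (isCompact_closedBall _ _).union (hfin.isCompact_sUnion fun D hD => (hdisk D hD.1).isCompact)
  obtain ⟨R, hR⟩ := hC.isBounded.subset_closedBall 0
  set R' := max R ρ
  have hR' : C ⊆ Metric.closedBall 0 R' :=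
    hR.trans (Metric.closedBall_subset_closedBall (le_max_left _ _))
  have hconn := isConnected_compl_closedBall_of_one_lt_rank one_lt_rank_plane
    (hρ.trans (le_max_right R ρ))
  obtain ⟨z, hz⟩ := hconn.nonempty
  have hOsub : (Metric.closedBall (0 : E) R')ᶜ ⊆ connectedComponentIn Cᶜ z :=
    hconn.isPreconnected.subset_connectedComponentIn hz (Set.compl_subset_compl.2 hR')
  set O := connectedComponentIn Cᶜ z
  have hOo : IsOpen O := hC.isClosed.isOpen_compl.connectedComponentIn
  have hOC : O ⊆ Cᶜ := connectedComponentIn_subset _ _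
  refine ⟨R' + 1, (le_max_right R ρ).trans (by linarith), fun h => absurd h (not_lt.2 hρ),
    O \ ⋃₀ 𝒟, hOo.sdiff (h𝒟.isClosed_sUnion hcl),
    hgen O hOo isPreconnected_connectedComponentIn ?_, ?_, fun x hx => hx.2, ?_⟩
  · rintro D hD ⟨y, hyD, hyO⟩
    have hD𝒞 : D ∉ 𝒞 := fun h => hOC hyO (Or.inr ⟨D, h, hyD⟩)
    have hDC : D ⊆ Cᶜ := by
      rintro x hx (h | ⟨D', hD', hxD'⟩)
      · exact hD𝒞 ⟨hD, x, hx, h⟩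
      · exact hD𝒞 (h𝒟.eq_of_mem hD hD'.1 hx hxD' ▸ hD')
    have := (hdisk D hD).isConnected.isPreconnected.subset_connectedComponentIn hyD hDC
    rwa [← connectedComponentIn_eq hyO] at this
  · intro x hx
    by_contra h
    exact hOC hx.1 (Or.inl (by simpa using h))
  · intro x hx hT
    refine ⟨hOsub ?_, hx⟩
    simp only [Set.mem_compl_iff, mem_closedBall_zero_iff, not_le]
    linarith

/-! ### Moving finitely many points. -/

/-- A tent function times `q - p` is Lipschitz with constant `‖q - p‖ / ε < 1`, so adding it to the
identity gives a homeomorphism. -/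
theorem exists_homeomorph_apply_eq_of_dist_lt {F : Type*} [NormedAddCommGroup F] [NormedSpace ℝ F]
    [CompleteSpace F] {p q : F} {ε : ℝ} (h : dist q p < ε) :
    ∃ f : F ≃ₜ F, f p = q ∧ {x | f x ≠ x} ⊆ Metric.ball p ε := by
  have hε : 0 < ε := dist_nonneg.trans_lt h
  rw [dist_eq_norm] at h
  set c : NNReal := ‖q - p‖₊ / ε.toNNReal
  have hc : (c : ℝ) = ‖q - p‖ / ε := by simp [c, hε.le]
  have hc1 : (c : ℝ) < 1 := by rw [hc, div_lt_one hε]; exact h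
  set φ : F → F := fun x => x + max (1 - ‖x - p‖ / ε) 0 • (q - p)
  have happ : ApproximatesLinearOn φ ((ContinuousLinearEquiv.refl ℝ F : F ≃L[ℝ] F) : F →L[ℝ] F)
      Set.univ c := by
    intro x _ y _
    have h1 : φ x - φ y - (x - y) =
        (max (1 - ‖x - p‖ / ε) 0 - max (1 - ‖y - p‖ / ε) 0) • (q - p) := by
      simp only [φ, sub_smul]; abel
    have h2 : |max (1 - ‖x - p‖ / ε) 0 - max (1 - ‖y - p‖ / ε) 0| ≤ ‖x - y‖ / ε := by
      refine (abs_max_sub_max_le_abs _ _ _).trans ?_ |>.trans (b := |‖y - p‖ - ‖x - p‖| / ε) ?_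
      · rw [← abs_of_pos hε, ← abs_div, abs_of_pos hε]
        refine le_of_eq (congrArg _ ?_)
        ring
      · refine div_le_div_of_nonneg_right ((abs_norm_sub_norm_le _ _).trans_eq ?_) hε.le
        rw [sub_sub_sub_cancel_right, norm_sub_rev]
    calc _ = |max (1 - ‖x - p‖ / ε) 0 - max (1 - ‖y - p‖ / ε) 0| * ‖q - p‖ := by
            rw [← Real.norm_eq_abs, ← norm_smul, ← h1]; rfl
      _ ≤ ‖x - y‖ / ε * ‖q - p‖ := by gcongr
      _ = c * ‖x - y‖ := by rw [hc]; ring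
  have hinv : Subsingleton F ∨
      c < ‖((ContinuousLinearEquiv.refl ℝ F).symm : F →L[ℝ] F)‖₊⁻¹ := by
    rcases subsingleton_or_nontrivial F with hF | hF
    · exact Or.inl hF
    · right
      have : ‖((ContinuousLinearEquiv.refl ℝ F).symm : F →L[ℝ] F)‖₊ = 1 :=
        ContinuousLinearMap.nnnorm_id
      rw [this, inv_one]
      exact_mod_cast hc1
  refine ⟨happ.toHomeomorph φ hinv, ?_, fun x hx => ?_⟩
  · change φ p = q
    simp [φ]
  · by_contra hxb
    refine hx ?_
    change φ x = x
    have : 1 ≤ ‖x - p‖ / ε := by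
      rw [one_le_div hε, ← dist_eq_norm]
      simpa using hxb
    simp [φ, max_eq_right (sub_nonpos.2 this)]

theorem Homeomorph.setOf_trans_ne_subset {X : Type*} [TopologicalSpace X] (f g : X ≃ₜ X) :
    {x | (f.trans g) x ≠ x} ⊆ {x | f x ≠ x} ∪ {x | g x ≠ x} := by
  intro x hx
  by_contra h
  simp only [Set.mem_union, Set.mem_ofPred_eq, not_or, not_not] at h
  exact hx (by simp [h.1, h.2])

theorem Homeomorph.setOf_symm_ne {X : Type*} [TopologicalSpace X] (f : X ≃ₜ X) :
    {x | f.symm x ≠ x} = {x | f x ≠ x} := by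
  ext x
  simp only [Set.mem_ofPred_eq, ne_eq, f.symm_apply_eq, eq_comm]

/-- A connected open set is homogeneous under homeomorphisms with bounded support inside it. -/
theorem IsPreconnected.exists_homeomorph_apply_eq {F : Type*} [NormedAddCommGroup F]
    [NormedSpace ℝ F] [CompleteSpace F] {W : Set F} (hW : IsPreconnected W) (hWo : IsOpen W)
    {p q : F} (hp : p ∈ W) (hq : q ∈ W) :
    ∃ f : F ≃ₜ F, f p = q ∧ {x | f x ≠ x} ⊆ W ∧ Bornology.IsBounded {x | f x ≠ x} := by
  refine hW.induction₂ (fun p q => ∃ f : F ≃ₜ F, f p = q ∧ {x | f x ≠ x} ⊆ W ∧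
    Bornology.IsBounded {x | f x ≠ x}) ?_ ?_ ?_ hp hq
  · intro x hx
    obtain ⟨ε, hε, hsub⟩ := Metric.isOpen_iff.1 hWo x hx
    refine Filter.Eventually.filter_mono nhdsWithin_le_nhds ?_
    filter_upwards [Metric.ball_mem_nhds x hε] with y hy
    obtain ⟨f, hf, hfs⟩ := exists_homeomorph_apply_eq_of_dist_lt hy
    exact ⟨f, hf, hfs.trans hsub, Metric.isBounded_ball.subset hfs⟩
  · rintro x y z - - - ⟨f, hf, hfW, hfb⟩ ⟨g, hg, hgW, hgb⟩
    have := Homeomorph.setOf_trans_ne_subset f g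
    exact ⟨f.trans g, by simp [hf, hg], this.trans (Set.union_subset hfW hgW),
      (hfb.union hgb).subset this⟩
  · rintro x y - - ⟨f, hf, hfW, hfb⟩
    rw [← f.setOf_symm_ne] at hfW hfb
    exact ⟨f.symm, by simp [← hf], hfW, hfb⟩

/-- Finitely many points of a connected open subset of the plane can be moved to prescribed new
positions, while the other points of a closed discrete set stay fixed. -/
theorem exists_homeomorph_finset {ι : Type*} {W Z : Set E} (hW : IsPreconnected W)
    (hWo : IsOpen W) (hZ : ∀ Z' ⊆ Z, IsClosed Z') {u v : ι → E} (hu : u.Injective)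
    (hv : v.Injective) (huv : ∀ i j, u i ≠ v j) (huZ : ∀ i, u i ∈ Z) (hvZ : ∀ i, v i ∈ Z)
    (s : Finset ι) (huW : ∀ i ∈ s, u i ∈ W) (hvW : ∀ i ∈ s, v i ∈ W) :
    ∃ f : E ≃ₜ E, {x | f x ≠ x} ⊆ W ∧ Bornology.IsBounded {x | f x ≠ x} ∧
      (∀ i ∈ s, f (u i) = v i) ∧ ∀ z ∈ Z, (∀ i ∈ s, z ≠ u i ∧ z ≠ v i) → f z = z := by
  classical
  induction s using Finset.induction_on with
  | empty => exact ⟨Homeomorph.refl E, by simp, by simp, by simp, by simp⟩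
  | insert a s ha ih =>
    obtain ⟨f, hfW, hfb, hfu, hfZ⟩ := ih (fun i hi => huW i (Finset.mem_insert_of_mem hi))
      fun i hi => hvW i (Finset.mem_insert_of_mem hi)
    have hZ' : ∀ Z' ⊆ Z \ {u a, v a}, IsClosed Z' := fun Z' h => hZ Z' (h.trans Set.sdiff_subset)
    obtain ⟨m, hm, hmW, hmb⟩ := (hW.diff_of_forall_subset_isClosed hWo hZ').exists_homeomorph_apply_eq
      (hWo.sdiff (hZ' _ subset_rfl)) (p := u a) (q := v a)
      ⟨huW a (Finset.mem_insert_self _ _), by simp⟩ ⟨hvW a (Finset.mem_insert_self _ _), by simp⟩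
    have hmZ : ∀ z ∈ Z, z ≠ u a → z ≠ v a → m z = z := by
      intro z hz h1 h2
      by_contra h
      exact (hmW h).2 ⟨hz, by simp [h1, h2]⟩
    have hsub := Homeomorph.setOf_trans_ne_subset f m
    refine ⟨f.trans m, hsub.trans (Set.union_subset hfW (hmW.trans Set.sdiff_subset)),
      (hfb.union hmb).subset hsub, ?_, ?_⟩
    · intro i hi
      rw [Homeomorph.trans_apply]
      rcases Finset.mem_insert.1 hi with rfl | hi
      · rw [hfZ _ (huZ i) fun j hj => ⟨fun h => ha (hu h ▸ hj), huv i j⟩, hm]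
      · rw [hfu i hi]
        exact hmZ _ (hvZ i) (huv a i).symm fun h => ha (hv h ▸ hi)
    · intro z hz h
      rw [Homeomorph.trans_apply, hfZ z hz fun i hi => h i (Finset.mem_insert_of_mem hi)]
      have := h a (Finset.mem_insert_self _ _)
      exact hmZ z hz this.1 this.2

/-! ### Gluing infinitely many moves. -/

/-- Homeomorphisms with pairwise disjoint, locally finite supports can be performed all at once. -/
theorem exists_homeomorph_of_locallyFinite {F ι : Type*} [AddCommGroup F] [TopologicalSpace F]
    [IsTopologicalAddGroup F] (f : ι → F ≃ₜ F)
    (hd : Pairwise fun i j => Disjoint {x | f i x ≠ x} {x | f j x ≠ x})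
    (hlf : LocallyFinite fun i => {x | f i x ≠ x}) :
    ∃ g : F ≃ₜ F, (∀ i x, f i x ≠ x → g x = f i x) ∧ ∀ x, (∀ i, f i x = x) → g x = x := by
  have main : ∀ f : ι → F ≃ₜ F, (Pairwise fun i j => Disjoint {x | f i x ≠ x} {x | f j x ≠ x}) →
      (LocallyFinite fun i => {x | f i x ≠ x}) → ∃ g : F → F, Continuous g ∧
        (∀ i x, f i x ≠ x → g x = f i x) ∧ ∀ x, (∀ i, f i x = x) → g x = x := by
    intro f hd hlf
    -- At each point at most one displacement is nonzero.
    refine ⟨fun x => x + ∑ᶠ i, (f i x - x), ?_, ?_, ?_⟩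
    · refine continuous_id.add (continuous_finsum (fun i => by fun_prop) ?_)
      convert hlf using 2 with i
      ext x
      simp [sub_eq_zero]
    · intro i x hx
      have : ∑ᶠ j, (f j x - x) = f i x - x := by
        refine finsum_eq_single _ i fun j hj => sub_eq_zero.2 ?_
        by_contra h
        exact Set.disjoint_left.1 (hd hj) h hx
      simp [this]
    · intro x hx
      simp [hx]
  obtain ⟨g, hgc, hg, hg'⟩ := main f hd hlf
  obtain ⟨k, hkc, hk, hk'⟩ := main (fun i => (f i).symm)
    (by simpa only [Homeomorph.setOf_symm_ne] using hd)
    (by simpa only [Homeomorph.setOf_symm_ne] using hlf)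
  refine ⟨⟨⟨g, k, fun x => ?_, fun x => ?_⟩, hgc, hkc⟩, hg, hg'⟩
  · by_cases h : ∃ i, f i x ≠ x
    · obtain ⟨i, hi⟩ := h
      rw [hg i x hi, hk i]
      · simp
      · simpa using hi.symm
    · push Not at h
      rw [hg' x h, hk' x fun i => by rw [Homeomorph.symm_apply_eq, h]]
  · by_cases h : ∃ i, f i x ≠ x
    · obtain ⟨i, hi⟩ := h
      have hi' : (f i).symm x ≠ x := fun h => hi (by rw [Homeomorph.symm_apply_eq] at h; exact h.symm)
      rw [hk i x hi', hg i]
      · simp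
      · simpa using hi'.symm
    · push Not at h
      rw [hk' x fun i => by rw [Homeomorph.symm_apply_eq, h], hg' x h]

theorem isClosed_of_forall_finite_inter_ball {F : Type*} [NormedAddCommGroup F] {Z : Set F}
    (h : ∀ r : ℝ, (Metric.ball 0 r ∩ Z).Finite) : IsClosed Z := by
  have hlf : LocallyFinite fun z : Z => ({(z : F)} : Set F) := by
    intro x
    refine ⟨Metric.ball 0 (‖x‖ + 1), Metric.isOpen_ball.mem_nhds (by simp), ?_⟩
    refine Set.Finite.of_finite_image ((h (‖x‖ + 1)).subset ?_) Subtype.val_injective.injOn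
    rintro _ ⟨z, ⟨y, hy, hyb⟩, rfl⟩
    obtain rfl : y = z := hy
    exact ⟨hyb, z.2⟩
  simpa using hlf.isClosed_iUnion fun _ => isClosed_singleton

theorem exists_homeomorph_of_forall_ne {𝒟 : Set (Set E)} (h𝒟 : IsDiscreteFamily 𝒟)
    (hdisk : ∀ D ∈ 𝒟, IsClosedDisk D) {ι : Type*} {u v : ι → E} (hu : u.Injective)
    (hv : v.Injective) (huv : ∀ i j, u i ≠ v j) (hu𝒟 : ∀ i, u i ∉ ⋃₀ 𝒟) (hv𝒟 : ∀ i, v i ∉ ⋃₀ 𝒟)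
    (hufin : ∀ r : ℝ, {i | ‖u i‖ < r}.Finite) (hvfin : ∀ r : ℝ, {i | ‖v i‖ < r}.Finite) :
    ∃ f : E ≃ₜ E, (∀ i, f (u i) = v i) ∧ ∀ x ∈ ⋃₀ 𝒟, f x = x := by
  have hZ : ∀ Z' ⊆ Set.range u ∪ Set.range v, IsClosed Z' := by
    intro Z' hZ'
    refine isClosed_of_forall_finite_inter_ball fun r => ?_
    refine (((hufin r).image u).union ((hvfin r).image v)).subset ?_
    rintro x ⟨hxr, hx⟩
    rw [mem_ball_zero_iff] at hxr
    rcases hZ' hx with ⟨i, rfl⟩ | ⟨i, rfl⟩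
    · exact Or.inl ⟨i, hxr, rfl⟩
    · exact Or.inr ⟨i, hxr, rfl⟩
  choose τ hτ hτ0 W hWo hW hWn hW𝒟 hWτ using exists_isPreconnected_open_of_norm_ge h𝒟 hdisk
  -- Scheduling by the smaller norm ensures that both `u i` and `v i` lie in `W ρ` once `τ ρ ≤ m i`.
  set m : ι → ℝ := fun i => min ‖u i‖ ‖v i‖
  have stage : ∀ ρ ρ' : ℝ, ∃ (f : E ≃ₜ E) (β : ℝ), (∀ x, f x ≠ x → ρ < ‖x‖ ∧ ‖x‖ ≤ β) ∧
      (∀ x ∈ ⋃₀ 𝒟, f x = x) ∧ (∀ i, τ ρ ≤ m i → m i < τ ρ' → f (u i) = v i) ∧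
      ∀ i, ¬ (τ ρ ≤ m i ∧ m i < τ ρ') → f (u i) = u i ∧ f (v i) = v i := by
    intro ρ ρ'
    have hfin : {i | τ ρ ≤ m i ∧ m i < τ ρ'}.Finite := by
      refine ((hufin (τ ρ')).union (hvfin (τ ρ'))).subset fun i hi => ?_
      exact min_lt_iff.1 hi.2
    obtain ⟨f, hfW, hfb, hf, hfZ⟩ := exists_homeomorph_finset (hW ρ) (hWo ρ) hZ hu hv huv
      (fun i => Or.inl ⟨i, rfl⟩) (fun i => Or.inr ⟨i, rfl⟩) hfin.toFinset
      (fun i hi => hWτ ρ _ (hu𝒟 i) (le_min_iff.1 ((hfin.mem_toFinset.1 hi).1)).1)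
      (fun i hi => hWτ ρ _ (hv𝒟 i) (le_min_iff.1 ((hfin.mem_toFinset.1 hi).1)).2)
    obtain ⟨β, hβ⟩ := hfb.exists_norm_le
    refine ⟨f, β, fun x hx => ⟨hWn ρ x (hfW hx), hβ x hx⟩, fun x hx => ?_,
      fun i h1 h2 => hf i (hfin.mem_toFinset.2 ⟨h1, h2⟩), fun i hi => ⟨?_, ?_⟩⟩
    · by_contra h
      exact hW𝒟 ρ (hfW h) hx
    · refine hfZ _ (Or.inl ⟨i, rfl⟩) fun j hj => ⟨fun h => ?_, huv i j⟩
      exact hi (hu h ▸ hfin.mem_toFinset.1 hj)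
    · refine hfZ _ (Or.inr ⟨i, rfl⟩) fun j hj => ⟨(huv j i).symm, fun h => ?_⟩
      exact hi (hv h ▸ hfin.mem_toFinset.1 hj)
  choose G β hGβ hG𝒟 hG hG' using stage
  -- The three terms make `ρ` unbounded, make `τ ∘ ρ` monotone, and bound the support of stage `n`
  -- by `ρ (n + 2)`. The start `-1` gives `τ (ρ 0) = 0`, so no index is missed.
  obtain ⟨ρ, hρ0, hρ1, hρ⟩ : ∃ ρ : ℕ → ℝ, ρ 0 = -1 ∧ ρ 1 = 0 ∧
      ∀ n, ρ (n + 2) = max (max (ρ (n + 1) + 1) (τ (ρ (n + 1)))) (β (ρ n) (ρ (n + 1))) := by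
    let s : ℕ → ℝ × ℝ := fun n =>
      Nat.rec (-1, 0) (fun _ p => (p.2, max (max (p.2 + 1) (τ p.2)) (β p.1 p.2))) n
    exact ⟨fun n => (s n).1, rfl, rfl, fun n => rfl⟩
  have hρsucc : ∀ n, ρ n + 1 ≤ ρ (n + 1) := by
    rintro (_ | n)
    · rw [hρ0, zero_add, hρ1]; norm_num
    · rw [hρ n]
      exact (le_max_left _ _).trans (le_max_left _ _)
  have hρmono : Monotone ρ := monotone_nat_of_le_succ fun n => by linarith [hρsucc n]
  have hρge : ∀ n : ℕ, (n : ℝ) - 1 ≤ ρ n := by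
    intro n
    induction n with
    | zero => simp [hρ0]
    | succ n ih => push_cast; linarith [hρsucc n]
  have hT0 : τ (ρ 0) = 0 := hτ0 _ (by rw [hρ0]; norm_num)
  have hTmono : Monotone fun n => τ (ρ n) := by
    refine monotone_nat_of_le_succ ?_
    rintro (_ | n)
    · rw [hT0, zero_add, hρ1]
      exact hτ 0
    · refine le_trans ?_ (hτ _)
      rw [hρ n]
      exact (le_max_right _ _).trans (le_max_left _ _)
  set f : ℕ → E ≃ₜ E := fun n => G (ρ n) (ρ (n + 1))
  have hfsupp : ∀ n x, f n x ≠ x → ρ n < ‖x‖ ∧ ‖x‖ ≤ ρ (n + 2) := by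
    intro n x hx
    have := hGβ _ _ x hx
    exact ⟨this.1, this.2.trans (by rw [hρ n]; exact le_max_right _ _)⟩
  have hlf : LocallyFinite fun n => {x | f n x ≠ x} := by
    intro x
    refine ⟨Metric.ball 0 (‖x‖ + 1), Metric.isOpen_ball.mem_nhds (by simp), ?_⟩
    refine (Set.finite_Iio (⌈‖x‖ + 2⌉₊)).subset ?_
    rintro n ⟨y, hy, hyb⟩
    rw [mem_ball_zero_iff] at hyb
    have h1 := (hfsupp n y hy).1
    have h2 := hρge n
    exact Nat.lt_ceil.2 (by linarith)
  have hlt : ∀ i j, i + 2 ≤ j → Disjoint {x | f i x ≠ x} {x | f j x ≠ x} := by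
    intro i j hij
    rw [Set.disjoint_left]
    intro x hx hx'
    exact absurd ((hfsupp j x hx').1.trans_le (hfsupp i x hx).2) (not_lt.2 (hρmono hij))
  have hglue : ∀ b : ℕ, ∃ g : E ≃ₜ E, (∀ k x, f (2 * k + b) x ≠ x → g x = f (2 * k + b) x) ∧
      ∀ x, (∀ k, f (2 * k + b) x = x) → g x = x := by
    intro b
    refine exists_homeomorph_of_locallyFinite (fun k => f (2 * k + b)) (fun i j hij => ?_)
      (hlf.comp_injective (g := fun k => 2 * k + b) fun i j h => by simpa using h)
    rcases lt_or_gt_of_ne hij with h | h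
    · exact hlt _ _ (by lia)
    · exact (hlt _ _ (by lia)).symm
  obtain ⟨g₀, h₀, h₀'⟩ := hglue 0
  obtain ⟨g₁, h₁, h₁'⟩ := hglue 1
  refine ⟨g₀.trans g₁, fun i => ?_, fun x hx => ?_⟩
  · obtain ⟨n, hn1, hn2⟩ : ∃ n, τ (ρ n) ≤ m i ∧ m i < τ (ρ (n + 1)) := by
      have hex : ∃ n, m i < τ (ρ (n + 1)) := by
        obtain ⟨n, hn⟩ := exists_nat_gt (m i)
        refine ⟨n, hn.trans_le (le_trans ?_ (hτ _))⟩
        have := hρge (n + 1)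
        push_cast at this
        linarith
      classical
      refine ⟨Nat.find hex, ?_, Nat.find_spec hex⟩
      rcases hk : Nat.find hex with _ | k
      · rw [hT0]
        exact le_min (norm_nonneg _) (norm_nonneg _)
      · exact not_lt.1 (Nat.find_min hex (hk ▸ Nat.lt_succ_self k))
    have hfn : f n (u i) = v i := hG _ _ i hn1 hn2
    have hfn' : f n (u i) ≠ u i := hfn ▸ (huv i i).symm
    have hother : ∀ k, k ≠ n → f k (u i) = u i ∧ f k (v i) = v i := by
      intro k hk
      refine hG' _ _ i ?_
      rintro ⟨hk1, hk2⟩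
      rcases lt_or_gt_of_ne hk with h | h
      · exact absurd (hk2.trans_le (hTmono (Nat.succ_le_of_lt h))) (not_lt.2 hn1)
      · exact absurd (hn2.trans_le (hTmono (Nat.succ_le_of_lt h))) (not_lt.2 hk1)
    rw [Homeomorph.trans_apply]
    rcases Nat.even_or_odd' n with ⟨k, rfl | rfl⟩
    · rw [h₀ k (u i) hfn', add_zero, hfn]
      exact h₁' _ fun j => (hother _ (by lia)).2
    · rw [h₀' (u i) fun j => (hother _ (by lia)).1, h₁ k (u i) hfn', hfn]
  · rw [Homeomorph.trans_apply, h₀' x fun k => hG𝒟 _ _ x hx, h₁' x fun k => hG𝒟 _ _ x hx]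

/-! ### The general case, through an intermediate set. -/

theorem mainTheorem4
    (𝒟 : Set (Set (EuclideanSpace ℝ (Fin 2))))
    (h𝒟 : IsDiscreteFamily 𝒟)
    (hdisk : ∀ D ∈ 𝒟, IsClosedDisk D)
    (A B : Set (EuclideanSpace ℝ (Fin 2)))
    (hA : A ⊆ (⋃₀ 𝒟)ᶜ)
    (hB : B ⊆ (⋃₀ 𝒟)ᶜ)
    (hfin : ∀ r : ℝ, 0 < r → (Metric.ball 0 r ∩ (A ∪ B)).Finite)
    (g : A ≃ B) :
    ∃ f : EuclideanSpace ℝ (Fin 2) ≃ₜ EuclideanSpace ℝ (Fin 2),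
      (∀ a : A, f a = g a) ∧ ∀ D ∈ 𝒟, ∀ x ∈ D, f x = x := by
  have hfin' : ∀ r : ℝ, (Metric.ball 0 r ∩ (A ∪ B)).Finite := fun r =>
    (hfin (max r 1) (by positivity)).subset
      (Set.inter_subset_inter_left _ (Metric.ball_subset_ball (le_max_left _ _)))
  have hopen : ∀ a : A, IsOpen ((⋃₀ 𝒟) ∪ ((A ∪ B) \ {(a : E)}))ᶜ := fun a =>
    ((h𝒟.isClosed_sUnion fun D hD => (hdisk D hD).isCompact.isClosed).union
      (isClosed_of_forall_finite_inter_ball fun r => (hfin' r).subset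
        (Set.inter_subset_inter_right _ Set.sdiff_subset))).isOpen_compl
  -- The bound `1` keeps the intermediate points `c a` locally finite; taking them within `ε a / 2`
  -- makes `c` injective.
  have hε : ∀ a : A, ∃ ε > 0, ε ≤ 1 ∧
      Metric.ball (a : E) ε ⊆ ((⋃₀ 𝒟) ∪ ((A ∪ B) \ {(a : E)}))ᶜ := by
    intro a
    obtain ⟨ε, hε, h⟩ := Metric.isOpen_iff.1 (hopen a) a (by simpa using hA a.2)
    exact ⟨min ε 1, by positivity, min_le_right _ _,
      (Metric.ball_subset_ball (min_le_left _ _)).trans h⟩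
  choose ε hε0 hε1 hεsub using hε
  have hc : ∀ a : A, ∃ c : E, c ≠ a ∧ dist c a < ε a / 2 := by
    intro a
    obtain ⟨w, hw⟩ := exists_norm_eq E (div_pos (hε0 a) (by norm_num : (0 : ℝ) < 4)).le
    refine ⟨a + w, ?_, ?_⟩
    · simp only [ne_eq, add_eq_left]
      rintro rfl
      have := hε0 a
      rw [norm_zero] at hw
      linarith
    · rw [dist_self_add_left, hw]
      linarith [hε0 a]
  choose c hca hcε using hc
  have hcsub : ∀ a, c a ∉ ⋃₀ 𝒟 ∧ c a ∉ A ∪ B := by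
    intro a
    have h := hεsub a (show c a ∈ Metric.ball (a : E) (ε a) by rw [Metric.mem_ball]; linarith [hcε a, hε0 a])
    simp only [Set.mem_compl_iff, Set.mem_union (c a) (⋃₀ 𝒟), not_or] at h
    exact ⟨h.1, fun h' => h.2 ⟨h', hca a⟩⟩
  have hcinj : Function.Injective c := by
    intro a a' h
    by_contra hne
    have key : ∀ a a' : A, a ≠ a' → ε a ≤ dist (a' : E) a := by
      intro a a' hne
      by_contra! hlt
      exact hεsub a hlt (Or.inr ⟨Or.inl a'.2, fun h => hne (Subtype.ext h).symm⟩)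
    have h1 := key a a' hne
    have h2 := key a' a (Ne.symm hne)
    have h3 := dist_triangle_left (a : E) a' (c a)
    have h4 := hcε a
    have h5 := hcε a'
    rw [← h] at h5
    rw [dist_comm] at h1
    linarith
  have hAfin : ∀ r : ℝ, {a : A | ‖(a : E)‖ < r}.Finite := fun r =>
    Set.Finite.of_finite_image ((hfin' r).subset (by
      rintro _ ⟨a, ha, rfl⟩
      exact ⟨mem_ball_zero_iff.2 ha, Or.inl a.2⟩)) Subtype.val_injective.injOn
  have hBfin : ∀ r : ℝ, {a : A | ‖(g a : E)‖ < r}.Finite := fun r =>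
    Set.Finite.of_finite_image (f := fun a => (g a : E)) ((hfin' r).subset (by
      rintro _ ⟨a, ha, rfl⟩
      exact ⟨mem_ball_zero_iff.2 ha, Or.inr (g a).2⟩))
      (Subtype.val_injective.comp g.injective).injOn
  have hCfin : ∀ r : ℝ, {a : A | ‖c a‖ < r}.Finite := by
    intro r
    refine (hAfin (r + 1)).subset fun a ha => ?_
    have h1 := hcε a
    have h2 : ‖(a : E)‖ ≤ ‖c a‖ + dist (c a) a := by
      rw [dist_comm, dist_eq_norm]
      have := norm_add_le (c a) ((a : E) - c a)
      rwa [add_sub_cancel] at this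
    have h3 : ‖c a‖ < r := ha
    have h4 := hε1 a
    have h5 := hε0 a
    change ‖(a : E)‖ < r + 1
    linarith
  obtain ⟨f₁, hf₁, hf₁𝒟⟩ := exists_homeomorph_of_forall_ne h𝒟 hdisk (u := fun a : A => (a : E))
    (v := c) Subtype.val_injective hcinj (fun a a' h => (hcsub a').2 (h ▸ Or.inl a.2))
    (fun a => hA a.2) (fun a => (hcsub a).1) hAfin hCfin
  obtain ⟨f₂, hf₂, hf₂𝒟⟩ := exists_homeomorph_of_forall_ne h𝒟 hdisk (u := c)
    (v := fun a : A => (g a : E)) hcinj (Subtype.val_injective.comp g.injective)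
    (fun a a' h => (hcsub a).2 (h ▸ Or.inr (g a').2))
    (fun a => (hcsub a).1) (fun a => hB (g a).2) hCfin hBfin
  refine ⟨f₁.trans f₂, fun a => ?_, fun D hD x hx => ?_⟩
  · rw [Homeomorph.trans_apply, hf₁, hf₂]
  · rw [Homeomorph.trans_apply, hf₁𝒟 x ⟨D, hD, hx⟩, hf₂𝒟 x ⟨D, hD, hx⟩]
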